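/- Let $G$ be a saturated graph on the node set $[n]=\{1,\dots,n\}$, $n\ge 1$: a finite undirected multigraph without loops in which any two distinct nodes $i,j$ are joined by $u_{ij}=u_{ji}\ge 1$ edges. Let $K$ be a field. For disjoint $I,J\subseteq[n]$ put $\mathbf x^{I\to J}=\prod_{i\in I}x_i^{\sum_{k\in J}u_{ik}}$, and let $$M_G=\bigl\langle\,\mathbf x^{I\to[n]\setminus I}\;:\;\emptyset\neq I\subseteq[n-1]\,\bigr\rangle\subseteq K[x_1,\dots,x_{n-1}].$$ A socle monomial of $K[x_1,\dots,x_{n-1}]/M_G$ is a monomial $\mathbf x^{\mathbf c}\notin M_G$ such that $x_i\mathbf x^{\mathbf c}\in M_G$ for $i=1,\dots,n-1$. A complete flag of subsets of $[n-1]$ is a chain $\mathcal T:\ \emptyset=T_0\subset T_1\subset\cdots\subset T_{n-1}$ of subsets of $[n-1]$ in which every $T_i\setminus T_{i-1}$ is a singleton; there are $(n-1)!$ of them. Write $\overline{T_i}=[n]\setminus T_i$. Then for every complete flag $\mathcal T$ the monomial $\operatorname{lcm}(\mathbf x^{T_1\to\overline{T_1}},\dots,\mathbf x^{T_{n-1}\to\overline{T_{n-1}}})$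 is divisible by $x_1x_2\cdots x_{n-1}$; the monomials $$\mathbf s_{\mathcal T}=\operatorname{lcm}\bigl(\mathbf x^{T_1\to\overline{T_1}},\dots,\mathbf x^{T_{n-1}\to\overline{T_{n-1}}}\bigr)/(x_1x_2\cdots x_{n-1})$$ are pairwise distinct for distinct $\mathcal T$; and the socle monomials of $K[x_1,\dots,x_{n-1}]/M_G$ are precisely the monomials $\mathbf s_{\mathcal T}$, where $\mathcal T$ runs over all complete flags of subsets of $[n-1]$. In particular there are exactly $(n-1)!$ socle monomials. -/

import Mathlib

open scoped Nat

/-- A finite loopless undirected multigraph on the node set `Fin n`, given by the number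
`u i j` of edges between the nodes `i` and `j`. -/
structure LooplessMultigraph (n : ℕ) where
  u : Fin n → Fin n → ℕ
  symm : ∀ i j, u i j = u j i
  loopless : ∀ i, u i i = 0

/-- Saturated: any two distinct nodes are connected by at least one edge. -/
def LooplessMultigraph.IsSaturated {n : ℕ} (G : LooplessMultigraph n) : Prop :=
  ∀ i j, i ≠ j → 0 < G.u i j

noncomputable section

namespace ParkingIdeal

/-! The graph has `n = m + 1` nodes; the last node is `Fin.last m` and the other nodes
`1, …, n - 1` are indexed by `Fin m`, through `Fin.castSucc`. The polynomial ring in the variables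
of the other nodes is `MvPolynomial (Fin m) K`; the monomial with exponent vector `c` is
`MvPolynomial.monomial c 1`. -/

variable {m : ℕ}

/-- The complement, in the full set of nodes, of a set of nodes other than the last one. -/
def nodeCompl (I : Finset (Fin m)) : Finset (Fin (m + 1)) :=
  (I.map Fin.castSuccEmb)ᶜ

/-- The exponent vector of `x^{I → J} = ∏_{i ∈ I} x_i ^ (∑_{k ∈ J} u_{ik})`. -/
def arrowExp (G : LooplessMultigraph (m + 1)) (I : Finset (Fin m)) (J : Finset (Fin (m + 1))) :
    Fin m →₀ ℕ :=
  ∑ i ∈ I, Finsupp.single i (∑ k ∈ J, G.u i.castSucc k)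

/-- The monomial ideal `M_G`, generated by the monomials `x^{I → Iᶜ}`, for `I` a non-empty set of
nodes other than the last one. -/
def idealM (K : Type*) [Field K] (G : LooplessMultigraph (m + 1)) :
    Ideal (MvPolynomial (Fin m) K) :=
  Ideal.span {p | ∃ I : Finset (Fin m), I.Nonempty ∧
    p = MvPolynomial.monomial (arrowExp G I (nodeCompl I)) 1}

/-- The socle monomials modulo an ideal `M`: the monomials that are not in `M` while their product
with each variable is in `M`. -/
def monSoc {σ K : Type*} [Field K] (M : Ideal (MvPolynomial σ K)) : Set (MvPolynomial σ K) :=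
  {p | (∃ c : σ →₀ ℕ, p = MvPolynomial.monomial c 1) ∧ p ∉ M ∧
    ∀ i, p * MvPolynomial.X i ∈ M}

/-- A complete flag `∅ = T_0 ⊂ T_1 ⊂ ⋯ ⊂ T_m` of subsets of an `m`-element set: all inclusions are
strict and all successive differences are singletons. -/
structure CompleteFlag (m : ℕ) where
  T : Fin (m + 1) → Finset (Fin m)
  zero : T 0 = ∅
  ssubset : ∀ i : Fin m, T i.castSucc ⊂ T i.succ
  singleton : ∀ i : Fin m, ∃ a, T i.succ \ T i.castSucc = {a}

/-- The exponent vector of the least common multiple of the monomials `x^{T_i → T_iᶜ}`, for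
`i = 1, …, m`: the componentwise maximum of their exponent vectors. -/
def flagLcmExp (G : LooplessMultigraph (m + 1)) (F : CompleteFlag m) : Fin m →₀ ℕ :=
  Finset.univ.sup fun i : Fin m => arrowExp G (F.T i.succ) (nodeCompl (F.T i.succ))

/-- The exponent vector of the lcm, lowered by one in each coordinate. That no coordinate of the lcm
is zero, so that this is an honest division by the product of the variables, is a part of the
theorem. -/
def flagSocleExp (G : LooplessMultigraph (m + 1)) (F : CompleteFlag m) : Fin m →₀ ℕ :=
  flagLcmExp G F - ∑ i : Fin m, Finsupp.single i 1

/-- The monomial `s_F = lcm_i (x^{T_i → T_iᶜ}) / (x_1 ⋯ x_m)` of a complete flag `F`. -/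
def flagSocleMonomial (K : Type*) [Field K] (G : LooplessMultigraph (m + 1)) (F : CompleteFlag m) :
    MvPolynomial (Fin m) K :=
  MvPolynomial.monomial (flagSocleExp G F) 1

end ParkingIdeal

end

/-! A flag is an enumeration `σ` of the nodes, its sets being the initial segments. Since
`outDegree` is antitone in the set, the lcm has at `x` the exponent `outDegree` of the segment
ending at `x`. A monomial `c` avoids the ideal iff every nonempty `I` contains some `x` with `c x <
outDegree G I x`. Burning then yields `σ` with `c` below the lcm in every coordinate
(`exists_perm_lt_outDegree`). So the monomials outside the ideal are the divisors of the flag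
monomials, and every socle monomial is a flag monomial. Conversely, saturation makes the bounds
strict (`lt_outDegree_iff`): on a segment, the flag exponent falls short of the out-degree only at
the last node. This gives the socle property and also recovers `σ`. -/

namespace ParkingIdeal

variable {m : ℕ}

/-! ### Out-degrees and membership in the ideal -/

/-- The number of edges from the node `x` to the complement of `I`. -/
def outDegree (G : LooplessMultigraph (m + 1)) (I : Finset (Fin m)) (x : Fin m) : ℕ :=
  ∑ k ∈ nodeCompl I, G.u x.castSucc k

theorem arrowExp_apply (G : LooplessMultigraph (m + 1)) (I : Finset (Fin m)) (x : Fin m) :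
    arrowExp G I (nodeCompl I) x = if x ∈ I then outDegree G I x else 0 := by
  simp [arrowExp, outDegree, Finsupp.finsetSum_apply, Finsupp.single_apply]

theorem castSucc_mem_nodeCompl {I : Finset (Fin m)} {x : Fin m} :
    x.castSucc ∈ nodeCompl I ↔ x ∉ I := by
  simp [nodeCompl]

theorem last_mem_nodeCompl (I : Finset (Fin m)) : Fin.last m ∈ nodeCompl I := by
  simp [nodeCompl, Fin.castSucc_ne_last]

theorem nodeCompl_anti {I J : Finset (Fin m)} (h : I ⊆ J) : nodeCompl J ⊆ nodeCompl I :=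
  Finset.compl_subset_compl.2 (Finset.map_subset_map.2 h)

theorem outDegree_anti (G : LooplessMultigraph (m + 1)) {I J : Finset (Fin m)} (h : I ⊆ J)
    (x : Fin m) : outDegree G J x ≤ outDegree G I x :=
  Finset.sum_le_sum_of_subset (nodeCompl_anti h)

theorem outDegree_pos {G : LooplessMultigraph (m + 1)} (hG : G.IsSaturated)
    (I : Finset (Fin m)) (x : Fin m) : 0 < outDegree G I x :=
  (hG _ _ (Fin.castSucc_ne_last x)).trans_le
    (Finset.single_le_sum (fun _ _ => Nat.zero_le _) (last_mem_nodeCompl I))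

theorem outDegree_lt {G : LooplessMultigraph (m + 1)} (hG : G.IsSaturated)
    {I J : Finset (Fin m)} (h : I ⊆ J) {x y : Fin m} (hxy : x ≠ y) (hyJ : y ∈ J) (hyI : y ∉ I) :
    outDegree G J x < outDegree G I x :=
  Finset.sum_lt_sum_of_subset (nodeCompl_anti h) (castSucc_mem_nodeCompl.2 hyI)
    (fun hy => castSucc_mem_nodeCompl.1 hy hyJ)
    (hG _ _ (fun e => hxy (Fin.castSucc_injective _ e))) (fun _ _ _ => Nat.zero_le _)

theorem arrowExp_le_iff (G : LooplessMultigraph (m + 1)) (I : Finset (Fin m))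
    (c : Fin m →₀ ℕ) :
    arrowExp G I (nodeCompl I) ≤ c ↔ ∀ x ∈ I, outDegree G I x ≤ c x := by
  rw [Finsupp.le_def]
  refine forall_congr' fun x => ?_
  rw [arrowExp_apply]
  split_ifs with h <;> simp [h]

theorem monomial_mem_idealM_iff (K : Type*) [Field K] (G : LooplessMultigraph (m + 1))
    (c : Fin m →₀ ℕ) :
    MvPolynomial.monomial c (1 : K) ∈ idealM K G ↔
      ∃ I : Finset (Fin m), I.Nonempty ∧ ∀ x ∈ I, outDegree G I x ≤ c x := by
  have h : idealM K G = Ideal.span ((fun s => MvPolynomial.monomial s (1 : K)) ''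
      {s | ∃ I : Finset (Fin m), I.Nonempty ∧ arrowExp G I (nodeCompl I) = s}) := by
    unfold idealM
    congr 1
    ext p
    constructor
    · rintro ⟨I, hI, rfl⟩
      exact ⟨_, ⟨I, hI, rfl⟩, rfl⟩
    · rintro ⟨_, ⟨I, hI, rfl⟩, rfl⟩
      exact ⟨I, hI, rfl⟩
  rw [h, MvPolynomial.mem_ideal_span_monomial_image]
  simp [arrowExp_le_iff]

/-! ### Flags as permutations -/

/-- The flag of initial segments of an enumeration of the nodes. -/
def flagOfPerm (σ : Equiv.Perm (Fin m)) : CompleteFlag m :=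
  have key : ∀ i : Fin m, (Finset.univ.filter fun x => (σ.symm x).castSucc < i.succ) \
      (Finset.univ.filter fun x => (σ.symm x).castSucc < i.castSucc) = {σ i} := fun i => by
    ext x
    simp only [Finset.mem_sdiff, Finset.mem_filter, Finset.mem_univ, true_and,
      Finset.mem_singleton, Fin.castSucc_lt_castSucc_iff, Fin.castSucc_lt_succ_iff, not_lt,
      ← Equiv.symm_apply_eq]
    exact le_antisymm_iff.symm
  { T := fun i => Finset.univ.filter fun x => (σ.symm x).castSucc < i
    zero := by simp
    ssubset := fun i => by
      refine Finset.ssubset_iff_subset_ne.2 ⟨fun x hx => ?_, fun e => ?_⟩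
      · simp only [Finset.mem_filter, Finset.mem_univ, true_and] at hx ⊢
        exact hx.trans Fin.castSucc_lt_succ
      · have := key i
        rw [e, sdiff_self] at this
        exact Finset.singleton_ne_empty _ this.symm
    singleton := fun i => ⟨σ i, key i⟩ }

theorem flagOfPerm_surjective : Function.Surjective (flagOfPerm (m := m)) := by
  intro F
  choose a ha using F.singleton
  have hsucc : ∀ i x, x ∈ F.T i.succ ↔ x ∈ F.T i.castSucc ∨ x = a i := fun i x => by
    rw [← Finset.mem_singleton, ← ha i, Finset.mem_sdiff]
    have h : x ∈ F.T i.castSucc → x ∈ F.T i.succ := fun hx => (F.ssubset i).1 hx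
    tauto
  have hmem : ∀ i x, x ∈ F.T i ↔ ∃ k : Fin m, k.castSucc < i ∧ a k = x := by
    intro i
    induction i using Fin.induction with
    | zero => simp [F.zero]
    | succ i ih =>
      intro x
      rw [hsucc, ih]
      simp only [Fin.castSucc_lt_castSucc_iff, Fin.castSucc_lt_succ_iff]
      constructor
      · rintro (⟨k, hk, rfl⟩ | rfl)
        · exact ⟨k, hk.le, rfl⟩
        · exact ⟨i, le_rfl, rfl⟩
      · rintro ⟨k, hk, rfl⟩
        rcases hk.lt_or_eq with h | rfl
        · exact Or.inl ⟨k, h, rfl⟩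
        · exact Or.inr rfl
  have hlt : ∀ k l, k < l → a k ≠ a l := fun k l hkl e => by
    have h1 : a l ∈ F.T l.castSucc := (hmem _ _).2 ⟨k, Fin.castSucc_lt_castSucc_iff.2 hkl, e⟩
    have h2 : a l ∈ F.T l.succ \ F.T l.castSucc := by rw [ha l]; exact Finset.mem_singleton_self _
    exact (Finset.mem_sdiff.1 h2).2 h1
  have hinj : Function.Injective a := fun k l e => by
    by_contra hne
    rcases lt_or_gt_of_ne hne with h | h
    · exact hlt _ _ h e
    · exact hlt _ _ h e.symm
  refine ⟨Equiv.ofBijective a (Finite.injective_iff_bijective.1 hinj), ?_⟩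
  have hT : (flagOfPerm (Equiv.ofBijective a (Finite.injective_iff_bijective.1 hinj))).T
      = F.T := by
    funext i
    ext x
    rw [hmem]
    simp only [flagOfPerm, Finset.mem_filter, Finset.mem_univ, true_and]
    constructor
    · exact fun h => ⟨_, h, Equiv.ofBijective_apply_symm_apply a _ x⟩
    · rintro ⟨k, hk, rfl⟩
      rwa [Equiv.ofBijective_symm_apply_apply]
  cases F
  simpa [flagOfPerm] using hT

/-- The nodes enumerated by `σ` not later than `x`. -/
def initialSegment (σ : Equiv.Perm (Fin m)) (x : Fin m) : Finset (Fin m) :=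
  Finset.univ.filter fun y => σ.symm y ≤ σ.symm x

theorem mem_initialSegment {σ : Equiv.Perm (Fin m)} {x y : Fin m} :
    y ∈ initialSegment σ x ↔ σ.symm y ≤ σ.symm x := by
  simp [initialSegment]

theorem initialSegment_subset {σ : Equiv.Perm (Fin m)} {x y : Fin m}
    (h : σ.symm y ≤ σ.symm x) : initialSegment σ y ⊆ initialSegment σ x :=
  fun _ hz => mem_initialSegment.2 ((mem_initialSegment.1 hz).trans h)

theorem flagOfPerm_succ (σ : Equiv.Perm (Fin m)) (i : Fin m) :
    (flagOfPerm σ).T i.succ = initialSegment σ (σ i) := by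
  ext x
  simp [flagOfPerm, mem_initialSegment, Fin.castSucc_lt_succ_iff]

/-- The segments containing `x` decrease its out-degree as they grow, so the smallest of them gives
the maximum. -/
theorem flagLcmExp_flagOfPerm (G : LooplessMultigraph (m + 1)) (σ : Equiv.Perm (Fin m))
    (x : Fin m) :
    flagLcmExp G (flagOfPerm σ) x = outDegree G (initialSegment σ x) x := by
  have happ : ∀ (s : Finset (Fin m)) (f : Fin m → Fin m →₀ ℕ),
      (s.sup f) x = s.sup fun i => f i x := fun s f =>
    Finset.apply_sup_eq_sup_comp (fun g : Fin m →₀ ℕ => g x) (fun _ _ => rfl) rfl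
  rw [flagLcmExp, happ]
  simp only [flagOfPerm_succ, arrowExp_apply, mem_initialSegment, Equiv.symm_apply_apply]
  apply le_antisymm
  · refine Finset.sup_le fun i _ => ?_
    split_ifs with h
    · exact outDegree_anti G (initialSegment_subset (by simpa using h)) x
    · exact Nat.zero_le _
  · refine le_trans ?_ (Finset.le_sup (Finset.mem_univ (σ.symm x)))
    simp

theorem flagSocleExp_flagOfPerm (G : LooplessMultigraph (m + 1)) (σ : Equiv.Perm (Fin m))
    (x : Fin m) :
    flagSocleExp G (flagOfPerm σ) x = outDegree G (initialSegment σ x) x - 1 := by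
  simp [flagSocleExp, flagLcmExp_flagOfPerm, Finsupp.single_apply]

theorem flagSocleExp_add_ones {G : LooplessMultigraph (m + 1)} (hG : G.IsSaturated)
    (F : CompleteFlag m) :
    flagSocleExp G F + ∑ i : Fin m, Finsupp.single i 1 = flagLcmExp G F := by
  obtain ⟨σ, rfl⟩ := flagOfPerm_surjective F
  ext x
  have := outDegree_pos hG (initialSegment σ x) x
  simp only [Finsupp.add_apply, flagSocleExp_flagOfPerm, flagLcmExp_flagOfPerm,
    Finsupp.finsetSum_apply, Finsupp.single_apply, Finset.sum_ite_eq', Finset.mem_univ, if_true]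
  omega

/-! ### Flag monomials are distinct socle monomials -/

theorem flagSocleMonomial_notMem (K : Type*) [Field K] {G : LooplessMultigraph (m + 1)}
    (hG : G.IsSaturated) (F : CompleteFlag m) : flagSocleMonomial K G F ∉ idealM K G := by
  obtain ⟨σ, rfl⟩ := flagOfPerm_surjective F
  rw [flagSocleMonomial, monomial_mem_idealM_iff]
  rintro ⟨I, hI, h⟩
  -- `I` lies in the segment ending at its last node `x`, so its out-degree at `x` exceeds the
  -- exponent.
  obtain ⟨x, hx, hmax⟩ := I.exists_max_image σ.symm hI
  have h1 := h x hx
  rw [flagSocleExp_flagOfPerm] at h1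
  have h2 := outDegree_anti G (fun y hy => mem_initialSegment.2 (hmax y hy)) x
  have h3 := outDegree_pos hG (initialSegment σ x) x
  omega

/-- For `y` before `x`, an edge from `y` to `x` leaves the segment of `y` but not that of `x`; this
loss absorbs the subtracted one. -/
theorem lt_outDegree_iff {G : LooplessMultigraph (m + 1)} (hG : G.IsSaturated)
    (σ : Equiv.Perm (Fin m)) {x y : Fin m} (hy : y ∈ initialSegment σ x) :
    flagSocleExp G (flagOfPerm σ) y < outDegree G (initialSegment σ x) y ↔ y = x := by
  rw [flagSocleExp_flagOfPerm]
  constructor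
  · intro h
    by_contra hne
    rw [mem_initialSegment] at hy
    have := outDegree_lt hG (initialSegment_subset hy) hne
      (mem_initialSegment.2 le_rfl) (fun hx => hne
        (σ.symm.injective (le_antisymm hy (mem_initialSegment.1 hx))))
    omega
  · rintro rfl
    exact Nat.sub_lt (outDegree_pos hG _ _) one_pos

theorem monomial_mul_X (K : Type*) [Field K] (c : Fin m →₀ ℕ) (i : Fin m) :
    MvPolynomial.monomial c (1 : K) * MvPolynomial.X i =
      MvPolynomial.monomial (c + Finsupp.single i 1) 1 := by
  rw [MvPolynomial.X, MvPolynomial.monomial_mul, one_mul]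

theorem flagSocleMonomial_mem_monSoc (K : Type*) [Field K] {G : LooplessMultigraph (m + 1)}
    (hG : G.IsSaturated) (F : CompleteFlag m) :
    flagSocleMonomial K G F ∈ monSoc (idealM K G) := by
  refine ⟨⟨_, rfl⟩, flagSocleMonomial_notMem K hG F, fun x => ?_⟩
  obtain ⟨σ, rfl⟩ := flagOfPerm_surjective F
  rw [flagSocleMonomial, monomial_mul_X, monomial_mem_idealM_iff]
  refine ⟨initialSegment σ x, ⟨x, mem_initialSegment.2 le_rfl⟩, fun y hy => ?_⟩
  rw [Finsupp.add_apply]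
  by_cases hyx : y = x
  · subst hyx
    rw [flagSocleExp_flagOfPerm, Finsupp.single_eq_same]
    omega
  · exact (not_lt.1 (mt (lt_outDegree_iff hG σ hy).1 hyx)).trans (Nat.le_add_right _ _)

/-- The enumeration is recovered from its end: agreement after `j` fixes the segment through `j`,
whose last node is the only one with exponent below its out-degree. -/
theorem flagSocleExp_flagOfPerm_injective {G : LooplessMultigraph (m + 1)}
    (hG : G.IsSaturated) : Function.Injective fun σ => flagSocleExp G (flagOfPerm σ) := by
  intro σ τ (e : flagSocleExp G (flagOfPerm σ) = flagSocleExp G (flagOfPerm τ))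
  ext1 j
  induction j using WellFoundedGT.induction with
  | ind j ih =>
    have hseg : initialSegment σ (σ j) = initialSegment τ (τ j) := by
      ext y
      simp only [mem_initialSegment, Equiv.symm_apply_apply]
      -- The complements consist of nodes placed after `j`, where `ih` applies.
      rw [← not_lt, ← not_lt, not_iff_not]
      constructor
      · intro h
        have := ih _ h
        rw [Equiv.apply_symm_apply] at this
        rwa [this, Equiv.symm_apply_apply]
      · intro h
        have := ih _ h
        rw [Equiv.apply_symm_apply] at this
        rwa [← this, Equiv.symm_apply_apply]
    have hmem : σ j ∈ initialSegment σ (σ j) := mem_initialSegment.2 le_rfl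
    have hlt := (lt_outDegree_iff hG σ hmem).2 rfl
    rw [hseg] at hmem hlt
    rw [e] at hlt
    exact (lt_outDegree_iff hG τ hmem).1 hlt

theorem flagOfPerm_injective_of_isSaturated {G : LooplessMultigraph (m + 1)}
    (hG : G.IsSaturated) : Function.Injective (flagOfPerm (m := m)) := fun _ _ e =>
  flagSocleExp_flagOfPerm_injective hG (congrArg (flagSocleExp G) e)

/-! ### Burning -/

/-- Dhar's burning algorithm, run inside a set `I` of nodes. -/
theorem exists_ranking {G : LooplessMultigraph (m + 1)} {c : Fin m →₀ ℕ}
    (hc : ∀ I : Finset (Fin m), I.Nonempty → ∃ x ∈ I, c x < outDegree G I x)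
    (I : Finset (Fin m)) :
    ∃ f : Fin m → ℕ, (∀ x ∈ I, f x < I.card) ∧ Set.InjOn f I ∧
      ∀ x ∈ I, c x < outDegree G (I.filter fun y => f y ≤ f x) x := by
  induction I using Finset.strongInduction with
  | H I ih =>
    rcases I.eq_empty_or_nonempty with rfl | hI
    · exact ⟨0, by simp⟩
    obtain ⟨a, ha, hca⟩ := hc I hI
    obtain ⟨f, hf, hinj, hfc⟩ := ih _ (Finset.erase_ssubset ha)
    have hcard := Finset.card_erase_add_one ha
    have hne : ∀ x ∈ I, x ≠ a → f x < (I.erase a).card := fun x hx hxa =>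
      hf x (Finset.mem_erase.2 ⟨hxa, hx⟩)
    -- The node `a` gets the top rank in `I`; the nodes ranked no later than another node then still
    -- lie in `I.erase a`.
    refine ⟨Function.update f a (I.erase a).card, fun x hx => ?_, fun x hx y hy e => ?_,
      fun x hx => ?_⟩
    · by_cases hxa : x = a
      · subst hxa
        rw [Function.update_self]
        omega
      · rw [Function.update_of_ne hxa]
        have := hne x hx hxa
        omega
    · by_cases hxa : x = a <;> by_cases hya : y = a
      · rw [hxa, hya]
      · subst hxa
        rw [Function.update_self, Function.update_of_ne hya] at e
        exact absurd e (hne y hy hya).ne'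
      · subst hya
        rw [Function.update_self, Function.update_of_ne hxa] at e
        exact absurd e (hne x hx hxa).ne
      · rw [Function.update_of_ne hxa, Function.update_of_ne hya] at e
        exact hinj (Finset.mem_erase.2 ⟨hxa, hx⟩) (Finset.mem_erase.2 ⟨hya, hy⟩) e
    · by_cases hxa : x = a
      · subst hxa
        exact hca.trans_le (outDegree_anti G (Finset.filter_subset _ _) x)
      · refine (hfc x (Finset.mem_erase.2 ⟨hxa, hx⟩)).trans_le (outDegree_anti G ?_ x)
        intro y hy
        rw [Finset.mem_filter] at hy
        rw [Function.update_of_ne hxa] at hy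
        have hya : y ≠ a := by
          rintro rfl
          rw [Function.update_self] at hy
          exact absurd hy.2 (hne x hx hxa).not_ge
        rw [Function.update_of_ne hya] at hy
        exact Finset.mem_filter.2 ⟨Finset.mem_erase.2 ⟨hya, hy.1⟩, hy.2⟩

theorem exists_perm_lt_outDegree {G : LooplessMultigraph (m + 1)} {c : Fin m →₀ ℕ}
    (hc : ∀ I : Finset (Fin m), I.Nonempty → ∃ x ∈ I, c x < outDegree G I x) :
    ∃ σ : Equiv.Perm (Fin m), ∀ x, c x < outDegree G (initialSegment σ x) x := by
  obtain ⟨f, -, hinj, hf⟩ := exists_ranking hc Finset.univ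
  have hmono : StrictMono (f ∘ Tuple.sort f) :=
    (Tuple.monotone_sort f).strictMono_of_injective
      ((Set.injOn_univ.1 (by simpa using hinj)).comp (Tuple.sort f).injective)
  refine ⟨Tuple.sort f, fun x => ?_⟩
  have hseg : initialSegment (Tuple.sort f) x = Finset.univ.filter fun y => f y ≤ f x := by
    ext y
    rw [mem_initialSegment, ← hmono.le_iff_le]
    simp
  rw [hseg]
  exact hf x (Finset.mem_univ x)

theorem monSoc_idealM (K : Type*) [Field K] {G : LooplessMultigraph (m + 1)}
    (hG : G.IsSaturated) :
    monSoc (idealM K G) = Set.range (flagSocleMonomial K G) := by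
  apply Set.Subset.antisymm
  · rintro _ ⟨⟨c, rfl⟩, hc, hX⟩
    rw [monomial_mem_idealM_iff] at hc
    push Not at hc
    obtain ⟨σ, hσ⟩ := exists_perm_lt_outDegree hc
    refine ⟨flagOfPerm σ, ?_⟩
    rw [flagSocleMonomial]
    refine congrArg (fun d => MvPolynomial.monomial d (1 : K)) (Finsupp.ext fun x => ?_)
    by_contra hne
    have hx := hX x
    rw [monomial_mul_X, monomial_mem_idealM_iff] at hx
    obtain ⟨I, hI, h⟩ := hx
    -- As `c` divides the flag monomial and is strictly smaller at `x`, its product with `X x` still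
    -- divides it, which would put the flag monomial in the ideal.
    refine flagSocleMonomial_notMem K hG (flagOfPerm σ)
      ((monomial_mem_idealM_iff K G _).2 ⟨I, hI, fun y hy => (h y hy).trans ?_⟩)
    have hy := hσ y
    rw [flagSocleExp_flagOfPerm] at hne ⊢
    rw [Finsupp.add_apply, Finsupp.single_apply]
    split_ifs with hxy
    · subst hxy
      omega
    · omega
  · rintro _ ⟨F, rfl⟩
    exact flagSocleMonomial_mem_monSoc K hG F

theorem flagSocleMonomial_injective (K : Type*) [Field K] {G : LooplessMultigraph (m + 1)}
    (hG : G.IsSaturated) : Function.Injective (flagSocleMonomial K G) := by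
  intro F F' e
  obtain ⟨σ, rfl⟩ := flagOfPerm_surjective F
  obtain ⟨τ, rfl⟩ := flagOfPerm_surjective F'
  exact congrArg flagOfPerm (flagSocleExp_flagOfPerm_injective hG
    (MvPolynomial.monomial_left_injective one_ne_zero e))

theorem card_completeFlag {G : LooplessMultigraph (m + 1)} (hG : G.IsSaturated) :
    Nat.card (CompleteFlag m) = m ! := by
  rw [← Nat.card_congr (Equiv.ofBijective flagOfPerm
    ⟨flagOfPerm_injective_of_isSaturated hG, flagOfPerm_surjective⟩), Nat.card_perm,
    Nat.card_eq_fintype_card, Fintype.card_fin]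

end ParkingIdeal

theorem mainTheorem7 {K : Type*} [Field K] {m : ℕ} (G : LooplessMultigraph (m + 1))
    (hG : G.IsSaturated) :
    (∀ F : ParkingIdeal.CompleteFlag m,
      ParkingIdeal.flagSocleMonomial K G F * ∏ i : Fin m, MvPolynomial.X i =
        MvPolynomial.monomial (ParkingIdeal.flagLcmExp G F) 1) ∧
    ParkingIdeal.monSoc (ParkingIdeal.idealM K G) =
      Set.range (ParkingIdeal.flagSocleMonomial K G) ∧
    Function.Injective (ParkingIdeal.flagSocleMonomial K G) ∧
    Nat.card (ParkingIdeal.CompleteFlag m) = m ! ∧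
    (ParkingIdeal.monSoc (ParkingIdeal.idealM K G)).ncard = m ! := by
  have hinj := ParkingIdeal.flagSocleMonomial_injective K hG
  have hcard := ParkingIdeal.card_completeFlag hG
  refine ⟨fun F => ?_, ParkingIdeal.monSoc_idealM K hG, hinj, hcard, ?_⟩
  · have hprod : ∏ i : Fin m, (MvPolynomial.X i : MvPolynomial (Fin m) K) =
        MvPolynomial.monomial (∑ i : Fin m, Finsupp.single i 1) 1 :=
      (MvPolynomial.monomial_sum_one _ _).symm
    rw [hprod, ParkingIdeal.flagSocleMonomial, MvPolynomial.monomial_mul, one_mul,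
      ParkingIdeal.flagSocleExp_add_ones hG]
  · rw [ParkingIdeal.monSoc_idealM K hG, ← Set.image_univ,
      Set.ncard_image_of_injective _ hinj, Set.ncard_univ, hcard]
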